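/- Let $\mathbb D=\{z\in\mathbb C:|z|<1\}$ carry the hyperbolic area $d\mathrm{vol}_H=(1-|z|^2)^{-2}\,dx\,dy$ and the hyperbolic distance $d^H(z,w)=\operatorname{artanh}\left|\frac{z-w}{1-\bar w z}\right|$ of the Riemannian metric $(1-|z|^2)^{-2}(dx^2+dy^2)$. Let $M_D$ be the group of disk Möbius transformations $m(z)=e^{i\theta}\frac{z-a}{1-\bar a z}$, $a\in\mathbb D$, $\theta\in[0,2\pi)$. Let $X$ be the set of conformal densities, that is, nonnegative $C^1$ functions $\mu$ on $\mathbb D$ with $\int_{\mathbb D}\mu\,d\mathrm{vol}_H=1$; such a $\mu$ is identified with the probability measure $\mu\,d\mathrm{vol}_H$. The group $M_D$ acts on $X$ by push-forward, $m_*\mu=\mu\circ m^{-1}$. Fix $\kappa>0$ (for instance $\kappa=1$) and, for $\mu,\nu\in X$, put $$\mathrm d(\mu,\nu)=\inf_{\pi\in\Pi(\mu,\nu)}\int_{\mathbb D\times\mathbb D}\kappa\, d^H(z,w)\,d\pi(z,w)\in[0,\infty],\qquad \mathrm{Distance}(\mu,\nu)=\inf_{m\in M_D}\mathrm d(m_*\mu,\nu)\in[0,\infty],$$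 where $\Pi(\mu,\nu)$ is the set of probability measures on $\mathbb D\times\mathbb D$ with marginals $\mu$ and $\nu$. Proposition. (1) $\mathrm{Distance}(\mu,\nu)$ depends only on the orbits $\overline\mu=\{m_*\mu: m\in M_D\}$ and $\overline\nu$, and it is an extended metric (a metric that may take the value $\infty$) on the set of orbits $\{\overline\mu:\mu\in X\}$. (2) On the set of orbits of those $\mu\in X$ with $\int_{\mathbb D}d^H(0,z)\,\mu(z)\,d\mathrm{vol}_H(z)<\infty$, $\mathrm{Distance}$ is finite, hence a genuine metric. (3) For all $\mu,\nu\in X$ there is $m\in M_D$ with $\mathrm{Distance}(\mu,\nu)=\mathrm d(m_*\mu,\nu)$. (4) For $\mu,\nu\in X$, if $\mathrm{Distance}(\mu,\nu)=0$, then $\nu=m_*\mu$ for some $m\in M_D$. -/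

import Mathlib

open MeasureTheory Metric
open scoped ENNReal ComplexConjugate Complex.UnitDisc

noncomputable section

/-! ### Disk Möbius transformations -/

theorem one_sub_conj_mul_ne_zero (a z : 𝔻) : (1 : ℂ) - conj (a : ℂ) * z ≠ 0 := by
  intro h
  have h1 : conj (a : ℂ) * z = 1 := (sub_eq_zero.mp h).symm
  have h2 : ‖(a : ℂ)‖ * ‖(z : ℂ)‖ = 1 := by
    rw [← RCLike.norm_conj (a : ℂ), ← norm_mul, h1, norm_one]
  nlinarith [a.norm_lt_one, z.norm_lt_one, norm_nonneg (a : ℂ), norm_nonneg (z : ℂ)]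

theorem normSq_one_sub_conj_mul (a z : ℂ) :
    Complex.normSq (1 - conj a * z) - Complex.normSq (z - a)
      = (1 - Complex.normSq a) * (1 - Complex.normSq z) := by
  simp only [Complex.normSq_apply, Complex.sub_re, Complex.sub_im, Complex.mul_re, Complex.mul_im,
    Complex.conj_re, Complex.conj_im, Complex.one_re, Complex.one_im]
  ring

theorem norm_mobius_lt_one (u : Circle) (a z : 𝔻) :
    ‖(u : ℂ) * ((z : ℂ) - a) / (1 - conj (a : ℂ) * z)‖ < 1 := by
  rw [norm_div, norm_mul, Circle.norm_coe, one_mul,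
    div_lt_one (norm_pos_iff.mpr (one_sub_conj_mul_ne_zero a z))]
  refine lt_of_pow_lt_pow_left₀ 2 (norm_nonneg _) ?_
  rw [← Complex.normSq_eq_norm_sq, ← Complex.normSq_eq_norm_sq, ← sub_pos,
    normSq_one_sub_conj_mul]
  exact mul_pos (sub_pos.mpr a.normSq_lt_one) (sub_pos.mpr z.normSq_lt_one)

/-- The disk Möbius transformation `z ↦ u (z - a) / (1 - conj a * z)`, with `|u| = 1`, `|a| < 1`. -/
def mobiusMap (u : Circle) (a z : 𝔻) : 𝔻 :=
  Complex.UnitDisc.mk ((u : ℂ) * ((z : ℂ) - a) / (1 - conj (a : ℂ) * z)) (norm_mobius_lt_one u a z)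

theorem coe_mobiusMap (u : Circle) (a z : 𝔻) :
    (mobiusMap u a z : ℂ) = (u : ℂ) * ((z : ℂ) - a) / (1 - conj (a : ℂ) * z) := rfl

theorem circle_mul_conj (u : Circle) : (u : ℂ) * conj (u : ℂ) = 1 := by
  rw [Complex.mul_conj, Circle.normSq_coe]; simp

theorem mobiusMap_leftInverse (u : Circle) (a z : 𝔻) :
    mobiusMap u⁻¹ (-(u • a)) (mobiusMap u a z) = z := by
  apply Complex.UnitDisc.coe_injective
  have h1 := one_sub_conj_mul_ne_zero a z
  have h2 := one_sub_conj_mul_ne_zero (-(u • a)) (mobiusMap u a z)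
  have hu := circle_mul_conj u
  have ht : (mobiusMap u a z : ℂ) * (1 - conj (a : ℂ) * z) = (u : ℂ) * ((z : ℂ) - a) := by
    rw [coe_mobiusMap, div_mul_cancel₀ _ h1]
  rw [coe_mobiusMap, div_eq_iff h2]
  simp only [Circle.coe_inv_eq_conj, Complex.UnitDisc.coe_neg,
    Complex.UnitDisc.coe_circle_smul, map_neg, map_mul]
  linear_combination conj (u : ℂ) * ht + (z : ℂ) * hu

theorem mobiusMap_rightInverse (u : Circle) (a z : 𝔻) :
    mobiusMap u a (mobiusMap u⁻¹ (-(u • a)) z) = z := by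
  have h := mobiusMap_leftInverse u⁻¹ (-(u • a)) z
  have ha : -(u⁻¹ • -(u • a)) = a := by
    apply Complex.UnitDisc.coe_injective
    have hu := circle_mul_conj u
    simp only [Circle.coe_inv_eq_conj, Complex.UnitDisc.coe_neg,
      Complex.UnitDisc.coe_circle_smul]
    linear_combination (a : ℂ) * hu
  rwa [inv_inv, ha] at h

theorem exists_mobiusMap_comp (u₁ u₂ : Circle) (a₁ a₂ : 𝔻) :
    ∃ (u : Circle) (a : 𝔻), ∀ z, mobiusMap u₁ a₁ (mobiusMap u₂ a₂ z) = mobiusMap u a z := by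
  have hu := circle_mul_conj u₂
  have hq := one_sub_conj_mul_ne_zero a₁ (-(u₂ • a₂))
  set q : ℂ := 1 - conj (a₁ : ℂ) * ((-(u₂ • a₂) : 𝔻) : ℂ) with hqdef
  have hq' : conj q ≠ 0 := (map_ne_zero _).mpr hq
  have hq1 : q = 1 + conj (a₁ : ℂ) * (u₂ * a₂) := by
    rw [hqdef]; simp only [Complex.UnitDisc.coe_neg, Complex.UnitDisc.coe_circle_smul]; ring
  have hq2 : conj q = 1 + a₁ * (conj (u₂ : ℂ) * conj (a₂ : ℂ)) := by
    rw [hq1]; simp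
  have hnorm : ‖(u₁ : ℂ) * u₂ * conj q / q‖ = 1 := by
    rw [norm_div, norm_mul, norm_mul, RCLike.norm_conj, Circle.norm_coe, Circle.norm_coe,
      one_mul, one_mul, div_self (norm_ne_zero_iff.mpr hq)]
  let u : Circle := ⟨(u₁ : ℂ) * u₂ * conj q / q, mem_sphere_zero_iff_norm.mpr hnorm⟩
  have hucoe : (u : ℂ) = (u₁ : ℂ) * u₂ * conj q / q := rfl
  let a : 𝔻 := mobiusMap u₂⁻¹ (-(u₂ • a₂)) a₁
  have hb : mobiusMap u₂ a₂ a = a₁ := mobiusMap_rightInverse u₂ a₂ a₁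
  have ha : (a : ℂ) * conj q = conj (u₂ : ℂ) * a₁ + a₂ := by
    have h := one_sub_conj_mul_ne_zero (-(u₂ • a₂)) a₁
    have e : (1 : ℂ) - conj ((-(u₂ • a₂) : 𝔻) : ℂ) * a₁ = conj q := by
      rw [hq2]; simp only [Complex.UnitDisc.coe_neg, Complex.UnitDisc.coe_circle_smul,
        map_neg, map_mul]; ring
    change (mobiusMap u₂⁻¹ (-(u₂ • a₂)) a₁ : ℂ) * conj q = _
    rw [coe_mobiusMap, e, div_mul_cancel₀ _ hq', Complex.UnitDisc.coe_neg,
      Complex.UnitDisc.coe_circle_smul, Circle.coe_inv_eq_conj]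
    linear_combination (a₂ : ℂ) * hu
  have ha' : conj (a : ℂ) * q = u₂ * conj (a₁ : ℂ) + conj (a₂ : ℂ) := by
    have := congrArg conj ha
    simpa using this
  refine ⟨u, a, fun z ↦ Complex.UnitDisc.coe_injective ?_⟩
  have h1 := one_sub_conj_mul_ne_zero a₂ z
  have h2 := one_sub_conj_mul_ne_zero a₁ (mobiusMap u₂ a₂ z)
  have h3 := one_sub_conj_mul_ne_zero a z
  have ht : (mobiusMap u₂ a₂ z : ℂ) * (1 - conj (a₂ : ℂ) * z) = (u₂ : ℂ) * ((z : ℂ) - a₂) := by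
    rw [coe_mobiusMap, div_mul_cancel₀ _ h1]
  rw [coe_mobiusMap, coe_mobiusMap u a, hucoe, div_eq_div_iff h2 h3]
  generalize (mobiusMap u₂ a₂ z : ℂ) = t at *
  refine mul_right_cancel₀ hq ?_
  refine mul_right_cancel₀ h1 ?_
  have e1 : (1 - conj (a : ℂ) * z) * q
      = q - (u₂ * conj (a₁ : ℂ) + conj (a₂ : ℂ)) * z := by rw [← ha']; ring
  have e2 : ((u₁ : ℂ) * u₂ * conj q / q) * ((z : ℂ) - a) * q
      = u₁ * u₂ * (conj q * z - (conj (u₂ : ℂ) * a₁ + a₂)) := by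
    rw [← ha]; field_simp
  have e3 : (t - a₁) * (1 - conj (a₂ : ℂ) * z)
      = u₂ * (conj q * z - (conj (u₂ : ℂ) * a₁ + a₂)) := by
    rw [hq2]
    linear_combination ht + (a₁ - a₁ * conj (a₂ : ℂ) * z) * hu
  have e4 : (1 - conj (a₁ : ℂ) * t) * (1 - conj (a₂ : ℂ) * z)
      = q - (u₂ * conj (a₁ : ℂ) + conj (a₂ : ℂ)) * z := by
    rw [hq1]
    linear_combination - conj (a₁ : ℂ) * ht
  calc _ = u₁ * ((t - a₁) * (1 - conj (a₂ : ℂ) * z)) * ((1 - conj (a : ℂ) * z) * q) := by ring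
    _ = ((u₁ : ℂ) * u₂ * conj q / q) * ((z : ℂ) - a) * q
        * ((1 - conj (a₁ : ℂ) * t) * (1 - conj (a₂ : ℂ) * z)) := by
      rw [e1, e2, e3, e4]; ring
    _ = _ := by ring

/-- The group of disk Möbius transformations, acting on the open unit disk. -/
def DiskMobius : Subgroup (Equiv.Perm 𝔻) where
  carrier := {m | ∃ (u : Circle) (a : 𝔻), ∀ z, m z = mobiusMap u a z}
  one_mem' := by
    refine ⟨1, 0, fun z ↦ Complex.UnitDisc.coe_injective ?_⟩
    simp [coe_mobiusMap]
  mul_mem' := by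
    rintro m₁ m₂ ⟨u₁, a₁, h₁⟩ ⟨u₂, a₂, h₂⟩
    obtain ⟨u, a, h⟩ := exists_mobiusMap_comp u₁ u₂ a₁ a₂
    exact ⟨u, a, fun z ↦ by rw [Equiv.Perm.mul_apply, h₂, h₁, h]⟩
  inv_mem' := by
    rintro m ⟨u, a, h⟩
    refine ⟨u⁻¹, -(u • a), fun z ↦ ?_⟩
    rw [Equiv.Perm.inv_def, Equiv.symm_apply_eq, h, mobiusMap_rightInverse]

/-- Every map `mobiusMap u a` is a bijection of the disk, hence belongs to `DiskMobius`. -/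
theorem exists_diskMobius (u : Circle) (a : 𝔻) :
    ∃ m : DiskMobius, ∀ z, (m : Equiv.Perm 𝔻) z = mobiusMap u a z :=
  ⟨⟨⟨mobiusMap u a, mobiusMap u⁻¹ (-(u • a)), mobiusMap_leftInverse u a,
    mobiusMap_rightInverse u a⟩, u, a, fun _ ↦ rfl⟩, fun _ ↦ rfl⟩

/-! ### Hyperbolic distance and area -/

/-- The hyperbolic distance of the metric `(1 - |z|²)⁻² (dx² + dy²)` on the unit disk. -/
def hypDist (z w : 𝔻) : ℝ :=
  Real.artanh ‖((z : ℂ) - w) / (1 - conj (w : ℂ) * z)‖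

instance : MeasurableSpace 𝔻 := borel 𝔻

instance : BorelSpace 𝔻 := ⟨rfl⟩

/-- The hyperbolic area measure `(1 - |z|²)⁻² dx dy` on the unit disk. -/
def hypArea : Measure 𝔻 :=
  (Measure.comap (fun z : 𝔻 ↦ (z : ℂ)) volume).withDensity
    fun z ↦ ENNReal.ofReal (((1 - ‖(z : ℂ)‖ ^ 2) ^ 2)⁻¹)

theorem range_coe_disc : Set.range (fun z : 𝔻 ↦ (z : ℂ)) = ball 0 1 := by
  ext z
  exact ⟨by rintro ⟨w, rfl⟩; exact w.2, fun h ↦ ⟨⟨z, h⟩, rfl⟩⟩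

theorem measurableEmbedding_coe_disc : MeasurableEmbedding (fun z : 𝔻 ↦ (z : ℂ)) :=
  Complex.UnitDisc.isEmbedding_coe.measurableEmbedding (range_coe_disc ▸ measurableSet_ball)

/-- Integration against hyperbolic area, written as an integral over the disk in `ℂ`. -/
theorem lintegral_hypArea (F : ℂ → ℝ≥0∞) (f : 𝔻 → ℝ≥0∞) (hF : ∀ z : 𝔻, F z = f z) :
    ∫⁻ z, f z ∂hypArea
      = ∫⁻ z in ball (0 : ℂ) 1, ENNReal.ofReal (((1 - ‖z‖ ^ 2) ^ 2)⁻¹) * F z := by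
  have hm : Measurable fun z : 𝔻 ↦ ENNReal.ofReal (((1 - ‖(z : ℂ)‖ ^ 2) ^ 2)⁻¹) := by
    have := measurableEmbedding_coe_disc.measurable
    fun_prop
  rw [hypArea, lintegral_withDensity_eq_lintegral_mul_non_measurable _ hm
    (Filter.Eventually.of_forall fun _ ↦ ENNReal.ofReal_lt_top)]
  rw [← range_coe_disc, ← measurableEmbedding_coe_disc.map_comap,
    measurableEmbedding_coe_disc.lintegral_map]
  simp [hF]

/-- The formula of a disk Möbius transformation on the ambient plane. -/
def mobiusFun (u : Circle) (a : 𝔻) (z : ℂ) : ℂ :=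
  (u : ℂ) * (z - a) / (1 - conj (a : ℂ) * z)

theorem hasDerivAt_mobiusFun (u : Circle) (a z : 𝔻) :
    HasDerivAt (mobiusFun u a)
      ((u : ℂ) * (1 - conj (a : ℂ) * a) / (1 - conj (a : ℂ) * z) ^ 2) (z : ℂ) := by
  have h := one_sub_conj_mul_ne_zero a z
  have h1 : HasDerivAt (fun z : ℂ ↦ (u : ℂ) * (z - a)) ((u : ℂ) * 1) (z : ℂ) :=
    ((hasDerivAt_id _).sub_const _).const_mul _
  have h2 : HasDerivAt (fun z : ℂ ↦ 1 - conj (a : ℂ) * z) (-(conj (a : ℂ) * 1)) (z : ℂ) :=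
    ((hasDerivAt_id _).const_mul _).const_sub _
  refine (h1.div h2 h).congr_deriv ?_
  congr 1
  ring

theorem contDiffOn_mobiusFun (u : Circle) (a : 𝔻) :
    ContDiffOn ℝ 1 (mobiusFun u a) (ball 0 1) := by
  have : ContDiffOn ℂ 1 (mobiusFun u a) (ball 0 1) := by
    refine ContDiffOn.div (by fun_prop) (by fun_prop) fun z hz ↦ ?_
    exact one_sub_conj_mul_ne_zero a ⟨z, hz⟩
  exact this.restrict_scalars ℝ

theorem mobius_jacobian (u : Circle) (a z : 𝔻) :
    ‖(u : ℂ) * (1 - conj (a : ℂ) * a) / (1 - conj (a : ℂ) * z) ^ 2‖ ^ 2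
        * ((1 - ‖mobiusFun u a z‖ ^ 2) ^ 2)⁻¹ = ((1 - ‖(z : ℂ)‖ ^ 2) ^ 2)⁻¹ := by
  have hD : Complex.normSq (1 - conj (a : ℂ) * z) ≠ 0 := by
    simpa using one_sub_conj_mul_ne_zero a z
  have ha : (1 - Complex.normSq (a : ℂ)) ≠ 0 := (sub_pos.mpr a.normSq_lt_one).ne'
  have hz : (1 - Complex.normSq (z : ℂ)) ≠ 0 := (sub_pos.mpr z.normSq_lt_one).ne'
  have key := normSq_one_sub_conj_mul (a : ℂ) z
  have e1 : Complex.normSq (1 - conj (a : ℂ) * a) = (1 - Complex.normSq (a : ℂ)) ^ 2 := by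
    rw [← Complex.normSq_eq_conj_mul_self, ← Complex.ofReal_one, ← Complex.ofReal_sub,
      Complex.normSq_ofReal]
    ring
  have e2 : 1 - ‖mobiusFun u a z‖ ^ 2 = (1 - Complex.normSq (a : ℂ))
      * (1 - Complex.normSq (z : ℂ)) / Complex.normSq (1 - conj (a : ℂ) * z) := by
    rw [← Complex.normSq_eq_norm_sq, mobiusFun, Complex.normSq_div, Complex.normSq_mul,
      Circle.normSq_coe, one_mul, ← key, sub_div, div_self hD]
  rw [e2, ← Complex.normSq_eq_norm_sq, ← Complex.normSq_eq_norm_sq, Complex.normSq_div,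
    Complex.normSq_mul, Circle.normSq_coe, one_mul, e1, map_pow]
  field_simp

/-- Hyperbolic area is invariant under disk Möbius transformations. -/
theorem lintegral_hypArea_comp (m : DiskMobius) (f : 𝔻 → ℝ≥0∞) :
    ∫⁻ z, f ((m : Equiv.Perm 𝔻) z) ∂hypArea = ∫⁻ z, f z ∂hypArea := by
  obtain ⟨m, u, a, hm⟩ := m
  have hcoe : ∀ z : 𝔻, mobiusFun u a z = m z := fun z ↦ by rw [hm]; rfl
  let F : ℂ → ℝ≥0∞ := Function.extend (fun z : 𝔻 ↦ (z : ℂ)) f 0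
  have hF : ∀ z : 𝔻, F z = f z := fun z ↦
    Complex.UnitDisc.coe_injective.extend_apply f 0 z
  have hcoe' : ∀ (z : ℂ) (hz : z ∈ ball (0 : ℂ) 1),
      mobiusFun u a z = m (Complex.UnitDisc.mk z (mem_ball_zero_iff.mp hz)) :=
    fun z hz ↦ hcoe (Complex.UnitDisc.mk z (mem_ball_zero_iff.mp hz))
  have himage : mobiusFun u a '' ball 0 1 = ball 0 1 := by
    ext w
    constructor
    · rintro ⟨z, hz, rfl⟩
      rw [hcoe' z hz]
      exact mem_ball_zero_iff.mpr (Complex.UnitDisc.norm_lt_one _)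
    · intro hw
      refine ⟨m.symm (Complex.UnitDisc.mk w (mem_ball_zero_iff.mp hw)),
        mem_ball_zero_iff.mpr (Complex.UnitDisc.norm_lt_one _), ?_⟩
      rw [hcoe, Equiv.apply_symm_apply, Complex.UnitDisc.coe_mk]
  have hinj : Set.InjOn (mobiusFun u a) (ball 0 1) := by
    intro z hz w hw h
    rw [hcoe' z hz, hcoe' w hw] at h
    exact (Complex.UnitDisc.mk_inj _ _).mp (m.injective (Complex.UnitDisc.coe_injective h))
  have hder : ∀ z ∈ ball (0 : ℂ) 1, HasFDerivWithinAt (mobiusFun u a)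
      ((ContinuousLinearMap.toSpanSingleton ℂ ((u : ℂ) * (1 - conj (a : ℂ) * a)
        / (1 - conj (a : ℂ) * z) ^ 2)).restrictScalars ℝ) (ball 0 1) z := fun z hz ↦
    ((hasDerivAt_mobiusFun u a ⟨z, hz⟩).hasFDerivAt.restrictScalars ℝ).hasFDerivWithinAt
  have hcv := lintegral_image_eq_lintegral_abs_det_fderiv_mul volume measurableSet_ball hder hinj
    (fun w ↦ ENNReal.ofReal (((1 - ‖w‖ ^ 2) ^ 2)⁻¹) * F w)
  rw [himage] at hcv
  rw [lintegral_hypArea F f hF, hcv,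
    lintegral_hypArea (F ∘ mobiusFun u a) _ fun z ↦ by rw [Function.comp_apply, hcoe, hF]]
  refine setLIntegral_congr_fun measurableSet_ball fun z hz ↦ ?_
  have hdet : ∀ c : ℂ, |((ContinuousLinearMap.toSpanSingleton ℂ c).restrictScalars ℝ :
      ℂ →L[ℝ] ℂ).det| = ‖c‖ ^ 2 := by
    intro c
    rw [ContinuousLinearMap.det, ContinuousLinearMap.coe_restrictScalars,
      LinearMap.det_restrictScalars]
    simp [Algebra.norm_complex_apply, Complex.normSq_eq_norm_sq]
  simp only [hdet, Function.comp_apply]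
  rw [← mul_assoc, ← ENNReal.ofReal_mul (sq_nonneg _)]
  have := mobius_jacobian u a ⟨z, hz⟩
  exact congrArg (fun t ↦ ENNReal.ofReal t * F (mobiusFun u a z)) this.symm

/-! ### Conformal densities, their Möbius orbits, and the quotient distance -/

/-- A conformal density: a nonnegative `C¹` function on the open unit disk whose integral with
respect to hyperbolic area is `1`. -/
structure ConformalDensity where
  toFun : 𝔻 → ℝ
  nonneg : ∀ z, 0 ≤ toFun z
  contDiff : ∃ F : ℂ → ℝ, ContDiffOn ℝ 1 F (ball 0 1) ∧ ∀ z : 𝔻, F z = toFun z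
  lintegral_eq_one : ∫⁻ z, ENNReal.ofReal (toFun z) ∂hypArea = 1

@[ext]
theorem ConformalDensity.ext {μ ν : ConformalDensity} (h : ∀ z, μ.toFun z = ν.toFun z) :
    μ = ν := by
  cases μ; cases ν; congr; exact funext h

/-- Push-forward of conformal densities, `m_* μ (w) = μ (m⁻¹ w)`. -/
instance : MulAction DiskMobius ConformalDensity where
  smul m μ :=
    { toFun := fun w ↦ μ.toFun ((m⁻¹ : DiskMobius).1 w)
      nonneg := fun w ↦ μ.nonneg _
      contDiff := by
        obtain ⟨F, hF, hFμ⟩ := μ.contDiff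
        obtain ⟨u, a, h⟩ := (m⁻¹ : DiskMobius).2
        have hcoe : ∀ z : 𝔻, mobiusFun u a z = (m⁻¹ : DiskMobius).1 z := fun z ↦ by rw [h]; rfl
        refine ⟨F ∘ mobiusFun u a, hF.comp (contDiffOn_mobiusFun u a) fun z hz ↦ ?_, fun z ↦ ?_⟩
        · have := hcoe (Complex.UnitDisc.mk z (mem_ball_zero_iff.mp hz))
          rw [Complex.UnitDisc.coe_mk] at this
          rw [this]
          exact mem_ball_zero_iff.mpr (Complex.UnitDisc.norm_lt_one _)
        · rw [Function.comp_apply, hcoe, hFμ]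
      lintegral_eq_one := by
        rw [lintegral_hypArea_comp m⁻¹ fun w ↦ ENNReal.ofReal (μ.toFun w)]
        exact μ.lintegral_eq_one }
  one_smul _ := ConformalDensity.ext fun _ ↦ by
    change ConformalDensity.toFun _ ((1 : DiskMobius)⁻¹.1 _) = _
    rw [inv_one]; rfl
  mul_smul m₁ m₂ μ := ConformalDensity.ext fun w ↦ by
    change μ.toFun ((m₁ * m₂)⁻¹.1 w) = μ.toFun (m₂⁻¹.1 (m₁⁻¹.1 w))
    rw [mul_inv_rev]; rfl

theorem ConformalDensity.smul_toFun (m : DiskMobius) (μ : ConformalDensity) (w : 𝔻) :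
    (m • μ).toFun w = μ.toFun ((m : Equiv.Perm 𝔻).symm w) := rfl

/-- The set of orbits of conformal densities under disk Möbius transformations. -/
abbrev MobiusOrbit : Type := MulAction.orbitRel.Quotient DiskMobius ConformalDensity

/-- The orbit `{m_* μ : m}` of a conformal density `μ`. -/
def ConformalDensity.orbit (μ : ConformalDensity) : MobiusOrbit :=
  Quotient.mk (MulAction.orbitRel DiskMobius ConformalDensity) μ

/-- The probability measure with density `μ` with respect to hyperbolic area. -/
def ConformalDensity.measure (μ : ConformalDensity) : Measure 𝔻 :=
  hypArea.withDensity fun z ↦ ENNReal.ofReal (μ.toFun z)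

/-- The set `Π(μ, ν)` of couplings. They are probability measures when `μ` and `ν` are. -/
def couplings (μ ν : Measure 𝔻) : Set (Measure (𝔻 × 𝔻)) :=
  {π | π.map Prod.fst = μ ∧ π.map Prod.snd = ν}

/-- The optimal transport (Wasserstein-1) cost between two conformal densities for the cost
function `κ * hypDist`; it may be infinite. -/
def transportDist (κ : ℝ) (μ ν : ConformalDensity) : ℝ≥0∞ :=
  ⨅ π ∈ couplings μ.measure ν.measure, ∫⁻ p, ENNReal.ofReal (κ * hypDist p.1 p.2) ∂π

/-- The quotient distance: the infimum of the transport cost between `m_* μ` and `ν`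
over all disk Möbius transformations `m`. -/
def quotDist (κ : ℝ) (μ ν : ConformalDensity) : ℝ≥0∞ :=
  ⨅ m : DiskMobius, transportDist κ (m • μ) ν

/-- `μ` has finite first moment for the hyperbolic distance. -/
def ConformalDensity.HasFiniteMoment (μ : ConformalDensity) : Prop :=
  ∫⁻ z, ENNReal.ofReal (hypDist 0 z) ∂μ.measure < ∞

/-- The set of orbits of conformal densities having finite first moment. -/
def finiteMomentOrbits : Set MobiusOrbit :=
  ConformalDensity.orbit '' {μ | μ.HasFiniteMoment}

end

noncomputable section

/-! ### The hyperbolic distance -/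

/-! Möbius maps are isometries of the hyperbolic distance and preserve hyperbolic area, so the
transport cost is unchanged when both densities are moved by the same map. Given that,
well-definedness on orbits, symmetry and the triangle inequality for the infimum over the group
follow from the corresponding facts for the transport cost, whose own triangle inequality comes from
gluing couplings (`exists_gluing`). The real content is attainment, from which definiteness follows.
Moving the group element out of the marginals and into the cost leaves a minimisation over triples
(rotation, centre, coupling) with fixed marginals. Couplings form a weakly compact set by Prokhorov
(`isCompact_couplings`), and the cost is jointly lower semicontinuous
(`lowerSemicontinuous_lintegral_prod`). The group itself is not compact, but a bounded cost confines
the centre to a hyperbolic ball (`exists_hypDist_le_of_lintegral_le`), and such balls are compact. A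
minimiser of cost zero lives on the diagonal, so its two marginals coincide; continuous densities
are determined by their measures, so the densities coincide as well. -/

instance : PolishSpace 𝔻 := (isOpen_ball (x := (0 : ℂ)) (ε := 1)).polishSpace

/-- The pseudo-hyperbolic distance on the unit disk. -/
def pseudoHypDist (z w : 𝔻) : ℝ := ‖((z : ℂ) - w) / (1 - conj (w : ℂ) * z)‖

theorem hypDist_eq_artanh (z w : 𝔻) : hypDist z w = Real.artanh (pseudoHypDist z w) := rfl

theorem pseudoHypDist_nonneg (z w : 𝔻) : 0 ≤ pseudoHypDist z w := norm_nonneg _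

theorem pseudoHypDist_lt_one (z w : 𝔻) : pseudoHypDist z w < 1 := by
  simpa [pseudoHypDist] using norm_mobius_lt_one 1 w z

theorem pseudoHypDist_mem_Ioo (z w : 𝔻) : pseudoHypDist z w ∈ Set.Ioo (-1 : ℝ) 1 :=
  ⟨by linarith [pseudoHypDist_nonneg z w], pseudoHypDist_lt_one z w⟩

theorem pseudoHypDist_comm (z w : 𝔻) : pseudoHypDist z w = pseudoHypDist w z := by
  have h : (1 : ℂ) - conj (w : ℂ) * z = conj (1 - conj (z : ℂ) * w) := by simp [mul_comm]
  rw [pseudoHypDist, pseudoHypDist, norm_div, norm_div, norm_sub_rev, h, RCLike.norm_conj]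

theorem pseudoHypDist_eq_zero {z w : 𝔻} : pseudoHypDist z w = 0 ↔ z = w := by
  rw [pseudoHypDist, norm_eq_zero, div_eq_zero_iff,
    or_iff_left (one_sub_conj_mul_ne_zero w z), sub_eq_zero, Complex.UnitDisc.coe_inj]

theorem pseudoHypDist_zero_right (z : 𝔻) : pseudoHypDist z 0 = ‖(z : ℂ)‖ := by
  simp [pseudoHypDist]

theorem continuous_pseudoHypDist : Continuous fun p : 𝔻 × 𝔻 ↦ pseudoHypDist p.1 p.2 := by
  have h1 : Continuous fun p : 𝔻 × 𝔻 ↦ (p.1 : ℂ) := by fun_prop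
  have h2 : Continuous fun p : 𝔻 × 𝔻 ↦ (p.2 : ℂ) := by fun_prop
  refine ((h1.sub h2).div ?_ fun p ↦ one_sub_conj_mul_ne_zero p.2 p.1).norm
  exact continuous_const.sub ((Complex.continuous_conj.comp h2).mul h1)

/-- Numerator and denominator acquire factors of equal modulus, `|1 - |a|²| / (|1 - āz| |1 - āw|)`,
which cancel. -/
theorem pseudoHypDist_mobiusMap (u : Circle) (a z w : 𝔻) :
    pseudoHypDist (mobiusMap u a z) (mobiusMap u a w) = pseudoHypDist z w := by
  have hA := one_sub_conj_mul_ne_zero a z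
  have hB := one_sub_conj_mul_ne_zero a w
  have hB' : (1 : ℂ) - a * conj (w : ℂ) ≠ 0 := by
    have := (map_ne_zero (starRingEnd ℂ)).mpr hB
    simpa using this
  have hn : (1 : ℂ) - conj (a : ℂ) * a ≠ 0 := one_sub_conj_mul_ne_zero a a
  have hzw := one_sub_conj_mul_ne_zero w z
  have hu := circle_mul_conj u
  have e1 : (mobiusMap u a z : ℂ) - mobiusMap u a w
      = u * ((z - w) * (1 - conj (a : ℂ) * a))
        / ((1 - conj (a : ℂ) * z) * (1 - conj (a : ℂ) * w)) := by
    rw [coe_mobiusMap, coe_mobiusMap, div_sub_div _ _ hA hB]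
    congr 1
    ring
  have e2 : 1 - conj (mobiusMap u a w : ℂ) * mobiusMap u a z
      = ((1 - conj (w : ℂ) * z) * (1 - conj (a : ℂ) * a))
        / ((1 - conj (a : ℂ) * z) * (1 - a * conj (w : ℂ))) := by
    rw [coe_mobiusMap, coe_mobiusMap]
    simp only [map_div₀, map_mul, map_sub, map_one, Complex.conj_conj]
    rw [div_mul_div_comm, mul_comm (1 - (a : ℂ) * _), eq_div_iff (mul_ne_zero hA hB'), sub_mul,
      div_mul_cancel₀ _ (mul_ne_zero hA hB')]
    linear_combination (-(conj (w : ℂ) - conj (a : ℂ)) * (z - a)) * hu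
  have e3 : ‖(1 : ℂ) - a * conj (w : ℂ)‖ = ‖1 - conj (a : ℂ) * w‖ := by
    rw [← RCLike.norm_conj]
    simp
  rw [pseudoHypDist, pseudoHypDist, e1, e2]
  simp only [norm_div, norm_mul, Circle.norm_coe, e3, one_mul]
  rw [div_div_div_cancel_right₀ (mul_ne_zero (norm_ne_zero_iff.mpr hA) (norm_ne_zero_iff.mpr hB)),
    mul_div_mul_right _ _ (norm_ne_zero_iff.mpr hn)]

/-- This is the triangle inequality through the origin. With `D = |1 - w̄z|²` and `P = (1 - |w|²)(1
- |z|²)`, the squared left side is `1 - P / D`, increasing in `D`. Since `D ≤ (1 + |z||w|)²`,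
replacing `D` by this bound gives exactly the squared right side. -/
theorem pseudoHypDist_le (z w : 𝔻) :
    pseudoHypDist z w ≤ (‖(z : ℂ)‖ + ‖(w : ℂ)‖) / (1 + ‖(z : ℂ)‖ * ‖(w : ℂ)‖) := by
  have hD := norm_pos_iff.mpr (one_sub_conj_mul_ne_zero w z)
  have key := normSq_one_sub_conj_mul (w : ℂ) z
  simp only [Complex.normSq_eq_norm_sq] at key
  have hDle : ‖(1 : ℂ) - conj (w : ℂ) * z‖ ≤ 1 + ‖(z : ℂ)‖ * ‖(w : ℂ)‖ := by
    refine (norm_sub_le _ _).trans_eq ?_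
    rw [norm_one, norm_mul, RCLike.norm_conj, mul_comm]
  have hz := z.norm_lt_one
  have hw := w.norm_lt_one
  have hz0 := norm_nonneg (z : ℂ)
  have hw0 := norm_nonneg (w : ℂ)
  have hpos : 0 < 1 + ‖(z : ℂ)‖ * ‖(w : ℂ)‖ := by positivity
  rw [pseudoHypDist, norm_div]
  refine le_of_sq_le_sq ?_ (by positivity)
  rw [div_pow, div_pow, div_le_div_iff₀ (by positivity) (by positivity)]
  have hsq : ‖(1 : ℂ) - conj (w : ℂ) * z‖ ^ 2 ≤ (1 + ‖(z : ℂ)‖ * ‖(w : ℂ)‖) ^ 2 := by gcongr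
  have hP : 0 ≤ (1 - ‖(w : ℂ)‖ ^ 2) * (1 - ‖(z : ℂ)‖ ^ 2) :=
    mul_nonneg (by nlinarith) (by nlinarith)
  generalize ‖(1 : ℂ) - conj (w : ℂ) * z‖ ^ 2 = D at *
  generalize ‖(z : ℂ) - w‖ ^ 2 = N at *
  generalize ‖(z : ℂ)‖ = s at *
  generalize ‖(w : ℂ)‖ = t at *
  obtain rfl : N = D - (1 - t ^ 2) * (1 - s ^ 2) := by linarith
  nlinarith [mul_le_mul_of_nonneg_left hsq hP]

theorem Real.artanh_add_artanh {s t : ℝ} (hs : s ∈ Set.Ico (0 : ℝ) 1) (ht : t ∈ Set.Ico (0 : ℝ) 1) :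
    artanh s + artanh t = artanh ((s + t) / (1 + s * t)) := by
  obtain ⟨hs0, hs1⟩ := hs
  obtain ⟨ht0, ht1⟩ := ht
  have hp : 0 < 1 + s * t := by positivity
  have h1 : (0 : ℝ) < 1 - s := by linarith
  have h2 : (0 : ℝ) < 1 - t := by linarith
  have hle : (s + t) / (1 + s * t) < 1 := by
    rw [div_lt_one hp]
    nlinarith
  have h3 : 0 < 1 - (s + t) / (1 + s * t) := by linarith
  rw [artanh_eq_half_log ⟨by linarith, hs1.le⟩, artanh_eq_half_log ⟨by linarith, ht1.le⟩,
    artanh_eq_half_log ⟨by linarith [show 0 ≤ (s + t) / (1 + s * t) by positivity], hle.le⟩,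
    ← mul_add, ← Real.log_mul (by positivity) (by positivity)]
  congr 2
  have h4 : 1 + s * t - (s + t) ≠ 0 := by nlinarith
  have : 1 - (s + t) / (1 + s * t) = (1 + s * t - (s + t)) / (1 + s * t) := by
    field_simp
  rw [this]
  field_simp
  ring

theorem hypDist_nonneg (z w : 𝔻) : 0 ≤ hypDist z w := Real.artanh_nonneg (pseudoHypDist_nonneg z w)

theorem hypDist_comm (z w : 𝔻) : hypDist z w = hypDist w z := by
  rw [hypDist_eq_artanh, pseudoHypDist_comm, ← hypDist_eq_artanh]

theorem hypDist_eq_zero {z w : 𝔻} : hypDist z w = 0 ↔ z = w := by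
  rw [hypDist_eq_artanh, Real.artanh_eq_zero_iff, ← pseudoHypDist_eq_zero]
  have := pseudoHypDist_mem_Ioo z w
  -- `artanh` also takes the value 0 outside `(-1, 1)`; the bounds on the pseudo-distance exclude
  -- those cases.
  exact ⟨by rintro (h | h | h) <;> linarith [this.1, this.2], fun h ↦ .inr (.inl h)⟩

theorem hypDist_self (z : 𝔻) : hypDist z z = 0 := hypDist_eq_zero.mpr rfl

theorem hypDist_mobiusMap (u : Circle) (a z w : 𝔻) :
    hypDist (mobiusMap u a z) (mobiusMap u a w) = hypDist z w := by
  rw [hypDist_eq_artanh, pseudoHypDist_mobiusMap, ← hypDist_eq_artanh]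

theorem hypDist_smul (m : DiskMobius) (z w : 𝔻) :
    hypDist ((m : Equiv.Perm 𝔻) z) ((m : Equiv.Perm 𝔻) w) = hypDist z w := by
  obtain ⟨m, u, a, h⟩ := m
  simp only [h, hypDist_mobiusMap]

theorem mobiusMap_self (u : Circle) (a : 𝔻) : mobiusMap u a a = 0 :=
  Complex.UnitDisc.coe_injective (by simp [coe_mobiusMap])

/-- By invariance the middle point may be moved to 0, where `pseudoHypDist_le` and the addition
formula for `artanh` apply. -/
theorem hypDist_triangle (x y z : 𝔻) : hypDist x z ≤ hypDist x y + hypDist y z := by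
  rw [← hypDist_mobiusMap 1 y x z, ← hypDist_mobiusMap 1 y x y, ← hypDist_mobiusMap 1 y y z,
    mobiusMap_self, hypDist_comm 0]
  generalize mobiusMap 1 y x = p
  generalize mobiusMap 1 y z = q
  rw [hypDist_eq_artanh, hypDist_eq_artanh, hypDist_eq_artanh, pseudoHypDist_zero_right,
    pseudoHypDist_zero_right,
    Real.artanh_add_artanh ⟨norm_nonneg _, p.norm_lt_one⟩ ⟨norm_nonneg _, q.norm_lt_one⟩]
  refine Real.artanh_le_artanh (pseudoHypDist_mem_Ioo p q).1 ?_ (pseudoHypDist_le p q)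
  have hp := p.norm_lt_one
  have hq := q.norm_lt_one
  rw [div_lt_one (by positivity)]
  nlinarith

theorem continuous_uncurry_hypDist : Continuous fun p : 𝔻 × 𝔻 ↦ hypDist p.1 p.2 := by
  have hc : ContinuousOn Real.artanh (Set.Ioo (-1) 1) := by
    intro x hx
    have h1 : (1 : ℝ) - x ≠ 0 := by linarith [hx.2]
    have h2 : √((1 + x) / (1 - x)) ≠ 0 :=
      (Real.sqrt_pos_of_pos (div_pos (by linarith [hx.1]) (by linarith [hx.2]))).ne'
    unfold Real.artanh
    fun_prop (disch := assumption)
  exact hc.comp_continuous continuous_pseudoHypDist fun p ↦ pseudoHypDist_mem_Ioo p.1 p.2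

@[fun_prop]
theorem continuous_hypDist {X : Type*} [TopologicalSpace X] {f g : X → 𝔻} (hf : Continuous f)
    (hg : Continuous g) : Continuous fun x ↦ hypDist (f x) (g x) := by
  have h := continuous_uncurry_hypDist.comp (hf.prodMk hg)
  exact h

/-- Hyperbolic balls about 0 are Euclidean balls of radius `tanh R < 1`, so they stay away from the
unit circle. For `R < 0` both sides are empty. -/
theorem isCompact_setOf_hypDist_le (R : ℝ) : IsCompact {a : 𝔻 | hypDist a 0 ≤ R} := by
  rw [Complex.UnitDisc.isEmbedding_coe.isCompact_iff]
  have : (fun z : 𝔻 ↦ (z : ℂ)) '' {a : 𝔻 | hypDist a 0 ≤ R} = closedBall 0 (Real.tanh R) := by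
    have key : ∀ a : 𝔻, hypDist a 0 ≤ R ↔ ‖(a : ℂ)‖ ≤ Real.tanh R := fun a ↦ by
      rw [← Real.artanh_le_artanh_iff ⟨by linarith [norm_nonneg (a : ℂ)], a.norm_lt_one⟩
        ⟨Real.neg_one_lt_tanh R, Real.tanh_lt_one R⟩, Real.artanh_tanh, hypDist_eq_artanh,
        pseudoHypDist_zero_right]
    ext z
    rw [mem_closedBall_zero_iff]
    constructor
    · rintro ⟨a, ha, rfl⟩
      exact (key a).mp ha
    · intro hz
      exact ⟨.mk z (hz.trans_lt (Real.tanh_lt_one R)), (key _).mpr hz, rfl⟩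
  rw [this]
  exact isCompact_closedBall _ _

theorem continuous_mobiusMap :
    Continuous fun p : (Circle × 𝔻) × 𝔻 ↦ mobiusMap p.1.1 p.1.2 p.2 := by
  rw [Complex.UnitDisc.isEmbedding_coe.continuous_iff]
  have h1 : Continuous fun p : (Circle × 𝔻) × 𝔻 ↦ (p.1.1 : ℂ) := by fun_prop
  have h2 : Continuous fun p : (Circle × 𝔻) × 𝔻 ↦ (p.1.2 : ℂ) := by fun_prop
  have h3 : Continuous fun p : (Circle × 𝔻) × 𝔻 ↦ (p.2 : ℂ) := by fun_prop
  exact (h1.mul (h3.sub h2)).div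
    (continuous_const.sub ((Complex.continuous_conj.comp h2).mul h3))
    fun p ↦ one_sub_conj_mul_ne_zero p.1.2 p.2

theorem continuous_diskMobius (m : DiskMobius) : Continuous (m : Equiv.Perm 𝔻) := by
  obtain ⟨m, u, a, h⟩ := m
  rw [show (m : 𝔻 → 𝔻) = mobiusMap u a from funext h]
  exact continuous_mobiusMap.comp (by fun_prop : Continuous fun z : 𝔻 ↦ ((u, a), z))


/-! ### Densities and the measures they define -/

theorem ConformalDensity.continuous (μ : ConformalDensity) : Continuous μ.toFun := by
  obtain ⟨F, hF, h⟩ := μ.contDiff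
  rw [show μ.toFun = fun z : 𝔻 ↦ F z from funext fun z ↦ (h z).symm]
  exact hF.continuousOn.comp_continuous Complex.UnitDisc.continuous_coe fun z ↦ z.2

theorem ConformalDensity.measurable_ofReal (μ : ConformalDensity) :
    Measurable fun z ↦ ENNReal.ofReal (μ.toFun z) :=
  μ.continuous.measurable.ennreal_ofReal

instance (μ : ConformalDensity) : IsProbabilityMeasure μ.measure :=
  ⟨by rw [ConformalDensity.measure, withDensity_apply _ .univ, setLIntegral_univ,
    μ.lintegral_eq_one]⟩

/-- Invariance of hyperbolic area is what makes composing the density with the inverse map agree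
with push-forward of the measure. -/
theorem ConformalDensity.measure_smul (m : DiskMobius) (μ : ConformalDensity) :
    (m • μ).measure = μ.measure.map (m : Equiv.Perm 𝔻) := by
  have hm := (continuous_diskMobius m).measurable
  ext s hs
  rw [Measure.map_apply hm hs, measure, measure, withDensity_apply _ hs,
    withDensity_apply _ (hm hs), ← lintegral_indicator hs, ← lintegral_indicator (hm hs),
    ← lintegral_hypArea_comp m]
  refine lintegral_congr fun z ↦ ?_
  by_cases hz : (m : Equiv.Perm 𝔻) z ∈ s
  · rw [Set.indicator_of_mem hz, Set.indicator_of_mem (Set.mem_preimage.mpr hz), smul_toFun,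
      Equiv.symm_apply_apply]
  · rw [Set.indicator_of_notMem hz, Set.indicator_of_notMem (mt Set.mem_preimage.mp hz)]

instance : hypArea.IsOpenPosMeasure := by
  have hc : (Measure.comap (fun z : 𝔻 ↦ (z : ℂ)) volume).IsOpenPosMeasure := by
    refine ⟨fun U hU hne ↦ ?_⟩
    rw [measurableEmbedding_coe_disc.comap_apply]
    have hop : Topology.IsOpenEmbedding fun z : 𝔻 ↦ (z : ℂ) :=
      ⟨Complex.UnitDisc.isEmbedding_coe, range_coe_disc ▸ isOpen_ball⟩
    exact (hop.isOpenMap U hU).measure_ne_zero _ (hne.image _)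
  have hm : Measurable fun z : 𝔻 ↦ ENNReal.ofReal (((1 - ‖(z : ℂ)‖ ^ 2) ^ 2)⁻¹) := by
    have := measurableEmbedding_coe_disc.measurable
    fun_prop
  refine (withDensity_absolutelyContinuous' hm.aemeasurable (.of_forall fun z ↦ ?_)).isOpenPosMeasure
  have := z.sq_norm_lt_one
  exact (ENNReal.ofReal_pos.mpr (inv_pos.mpr (pow_pos (by linarith) 2))).ne'

/-- Equal measures give densities equal almost everywhere; continuity, and the fact that hyperbolic
area charges every nonempty open set, upgrade this to equality everywhere. -/
theorem ConformalDensity.measure_injective : Function.Injective ConformalDensity.measure := by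
  intro μ ν h
  have hae := (withDensity_eq_iff μ.measurable_ofReal.aemeasurable ν.measurable_ofReal.aemeasurable
    (by rw [μ.lintegral_eq_one]; exact ENNReal.one_ne_top)).mp h
  have heq := (Continuous.ae_eq_iff_eq _ (ENNReal.continuous_ofReal.comp μ.continuous)
    (ENNReal.continuous_ofReal.comp ν.continuous)).mp hae
  exact ConformalDensity.ext fun z ↦
    (ENNReal.ofReal_eq_ofReal_iff (μ.nonneg z) (ν.nonneg z)).mp (congrFun heq z)

/-! ### Couplings -/

theorem isProbabilityMeasure_of_mem_couplings {μ ν : Measure 𝔻} [IsProbabilityMeasure μ]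
    {π : Measure (𝔻 × 𝔻)} (h : π ∈ couplings μ ν) : IsProbabilityMeasure π := by
  refine ⟨?_⟩
  rw [← measure_univ (μ := μ), ← h.1, Measure.map_apply measurable_fst .univ, Set.preimage_univ]

theorem prod_mem_couplings (μ ν : Measure 𝔻) [IsProbabilityMeasure μ] [IsProbabilityMeasure ν] :
    μ.prod ν ∈ couplings μ ν := by
  constructor <;> simp

theorem map_diag_mem_couplings (μ : Measure 𝔻) : μ.map (fun z ↦ (z, z)) ∈ couplings μ μ := by
  have h : Measurable fun z : 𝔻 ↦ (z, z) := by fun_prop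
  exact ⟨by rw [Measure.map_map measurable_fst h]; exact Measure.map_id,
    by rw [Measure.map_map measurable_snd h]; exact Measure.map_id⟩

theorem map_swap_mem_couplings {μ ν : Measure 𝔻} {π : Measure (𝔻 × 𝔻)} (h : π ∈ couplings μ ν) :
    π.map Prod.swap ∈ couplings ν μ :=
  ⟨by rw [Measure.map_map measurable_fst measurable_swap]; exact h.2,
    by rw [Measure.map_map measurable_snd measurable_swap]; exact h.1⟩

theorem map_prodMap_mem_couplings {μ ν : Measure 𝔻} {π : Measure (𝔻 × 𝔻)} (h : π ∈ couplings μ ν)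
    {f g : 𝔻 → 𝔻} (hf : Measurable f) (hg : Measurable g) :
    π.map (Prod.map f g) ∈ couplings (μ.map f) (ν.map g) := by
  have hfg := hf.prodMap hg
  refine ⟨?_, ?_⟩
  · rw [← h.1, Measure.map_map measurable_fst hfg, Measure.map_map hf measurable_fst]; rfl
  · rw [← h.2, Measure.map_map measurable_snd hfg, Measure.map_map hg measurable_snd]; rfl

/-- Gluing of two finite measures along a common marginal. -/
theorem exists_gluing {X Y Z : Type*} [MeasurableSpace X] [MeasurableSpace Y] [MeasurableSpace Z]
    [StandardBorelSpace Z] [Nonempty Z] (π₁ : Measure (X × Y)) (π₂ : Measure (Y × Z))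
    [IsFiniteMeasure π₁] [IsFiniteMeasure π₂] (h : π₁.map Prod.snd = π₂.map Prod.fst) :
    ∃ Γ : Measure ((X × Y) × Z), Γ.map Prod.fst = π₁ ∧
      Γ.map (fun p ↦ (p.1.2, p.2)) = π₂ := by
  let K := π₂.condKernel
  -- Given `(x, y)` drawn from `π₁`, the third coordinate follows the conditional law of `π₂` given
  -- `y`.
  let Γ := π₁.compProd (K.comap Prod.snd measurable_snd)
  refine ⟨Γ, Measure.fst_compProd _ _, ?_⟩
  have hg : Measurable fun p : (X × Y) × Z ↦ (p.1.2, p.2) := by fun_prop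
  refine Measure.ext_of_lintegral _ fun f hf ↦ ?_
  rw [lintegral_map hf hg, Measure.lintegral_compProd (f := fun p : (X × Y) × Z ↦ f (p.1.2, p.2))
    (hf.comp hg)]
  conv_rhs => rw [← π₂.disintegrate K, Measure.lintegral_compProd hf, Measure.fst, ← h,
    lintegral_map hf.lintegral_kernel_prod_right' measurable_snd]
  rfl

/-! ### The transport distance -/

@[fun_prop]
theorem measurable_hypDist {X : Type*} [MeasurableSpace X] {f g : X → 𝔻}
    (hf : Measurable f) (hg : Measurable g) : Measurable fun x ↦ hypDist (f x) (g x) := by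
  have h := continuous_uncurry_hypDist.measurable.comp (hf.prodMk hg)
  exact h

theorem measurable_cost (κ : ℝ) :
    Measurable fun p : 𝔻 × 𝔻 ↦ ENNReal.ofReal (κ * hypDist p.1 p.2) := by
  fun_prop

theorem transportDist_le_lintegral {κ : ℝ} {μ ν : ConformalDensity} {π : Measure (𝔻 × 𝔻)}
    (h : π ∈ couplings μ.measure ν.measure) :
    transportDist κ μ ν ≤ ∫⁻ p, ENNReal.ofReal (κ * hypDist p.1 p.2) ∂π :=
  iInf₂_le π h

theorem transportDist_self (κ : ℝ) (μ : ConformalDensity) : transportDist κ μ μ = 0 := by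
  refine le_antisymm ((transportDist_le_lintegral (map_diag_mem_couplings _)).trans_eq ?_) bot_le
  rw [lintegral_map (measurable_cost κ) (by fun_prop)]
  simp [hypDist_self]

theorem transportDist_comm_le (κ : ℝ) (μ ν : ConformalDensity) :
    transportDist κ μ ν ≤ transportDist κ ν μ := by
  refine le_iInf₂ fun π hπ ↦ (transportDist_le_lintegral (map_swap_mem_couplings hπ)).trans_eq ?_
  rw [lintegral_map (measurable_cost κ) measurable_swap]
  exact lintegral_congr fun p ↦ by rw [Prod.fst_swap, Prod.snd_swap, hypDist_comm]

theorem transportDist_comm (κ : ℝ) (μ ν : ConformalDensity) :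
    transportDist κ μ ν = transportDist κ ν μ :=
  le_antisymm (transportDist_comm_le κ μ ν) (transportDist_comm_le κ ν μ)

theorem transportDist_smul_smul_le (κ : ℝ) (m : DiskMobius) (μ ν : ConformalDensity) :
    transportDist κ (m • μ) (m • ν) ≤ transportDist κ μ ν := by
  have hm := (continuous_diskMobius m).measurable
  refine le_iInf₂ fun π hπ ↦ ?_
  have h := map_prodMap_mem_couplings hπ hm hm
  rw [← ConformalDensity.measure_smul, ← ConformalDensity.measure_smul] at h
  refine (transportDist_le_lintegral h).trans_eq ?_
  rw [lintegral_map (measurable_cost κ) (hm.prodMap hm)]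
  exact lintegral_congr fun p ↦ by rw [Prod.map_fst, Prod.map_snd, hypDist_smul]

theorem transportDist_smul_smul (κ : ℝ) (m : DiskMobius) (μ ν : ConformalDensity) :
    transportDist κ (m • μ) (m • ν) = transportDist κ μ ν := by
  refine le_antisymm (transportDist_smul_smul_le κ m μ ν) ?_
  simpa using transportDist_smul_smul_le κ m⁻¹ (m • μ) (m • ν)

theorem ofReal_mul_hypDist_triangle {κ : ℝ} (hκ : 0 ≤ κ) (x y z : 𝔻) :
    ENNReal.ofReal (κ * hypDist x z)
      ≤ ENNReal.ofReal (κ * hypDist x y) + ENNReal.ofReal (κ * hypDist y z) := by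
  rw [← ENNReal.ofReal_add (mul_nonneg hκ (hypDist_nonneg _ _))
    (mul_nonneg hκ (hypDist_nonneg _ _)), ← mul_add]
  exact ENNReal.ofReal_le_ofReal (mul_le_mul_of_nonneg_left (hypDist_triangle x y z) hκ)

theorem transportDist_triangle {κ : ℝ} (hκ : 0 ≤ κ) (μ ν ρ : ConformalDensity) :
    transportDist κ μ ρ ≤ transportDist κ μ ν + transportDist κ ν ρ := by
  have key : ∀ π₁ ∈ couplings μ.measure ν.measure, ∀ π₂ ∈ couplings ν.measure ρ.measure,
      transportDist κ μ ρ ≤ ∫⁻ p, ENNReal.ofReal (κ * hypDist p.1 p.2) ∂π₁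
        + ∫⁻ p, ENNReal.ofReal (κ * hypDist p.1 p.2) ∂π₂ := by
    intro π₁ h₁ π₂ h₂
    have := isProbabilityMeasure_of_mem_couplings h₁
    have := isProbabilityMeasure_of_mem_couplings h₂
    obtain ⟨Γ, hΓ₁, hΓ₂⟩ := exists_gluing π₁ π₂ (h₁.2.trans h₂.1.symm)
    have hg : Measurable fun p : (𝔻 × 𝔻) × 𝔻 ↦ (p.1.2, p.2) := by fun_prop
    have hk : Measurable fun p : (𝔻 × 𝔻) × 𝔻 ↦ (p.1.1, p.2) := by fun_prop
    have hΓ : Γ.map (fun p ↦ (p.1.1, p.2)) ∈ couplings μ.measure ρ.measure := by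
      refine ⟨?_, ?_⟩
      · rw [← h₁.1, ← hΓ₁, Measure.map_map measurable_fst hk,
          Measure.map_map measurable_fst measurable_fst]
        rfl
      · rw [← h₂.2, ← hΓ₂, Measure.map_map measurable_snd hk, Measure.map_map measurable_snd hg]
        rfl
    refine (transportDist_le_lintegral hΓ).trans ?_
    rw [← hΓ₁, ← hΓ₂, lintegral_map (measurable_cost κ) hk, lintegral_map (measurable_cost κ) hg,
      lintegral_map (measurable_cost κ) measurable_fst,
      ← lintegral_add_left (f := fun p : (𝔻 × 𝔻) × 𝔻 ↦ ENNReal.ofReal (κ * hypDist p.1.1 p.1.2))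
        ((measurable_cost κ).comp measurable_fst)]
    exact lintegral_mono fun p ↦ ofReal_mul_hypDist_triangle hκ _ _ _
  conv_rhs => rw [transportDist, transportDist, iInf_subtype', iInf_subtype']
  exact ENNReal.le_iInf_add_iInf fun π₁ π₂ ↦ key π₁ π₁.2 π₂ π₂.2

/-- The product coupling already has finite cost: bound the distance by going through 0. -/
theorem transportDist_lt_top {κ : ℝ} (hκ : 0 ≤ κ) {μ ν : ConformalDensity}
    (hμ : μ.HasFiniteMoment) (hν : ν.HasFiniteMoment) : transportDist κ μ ν < ∞ := by
  refine (transportDist_le_lintegral (prod_mem_couplings _ _)).trans_lt ?_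
  have hm : Measurable fun z ↦ ENNReal.ofReal (κ * hypDist 0 z) := by
    fun_prop
  have hfin : ∀ ρ : ConformalDensity, ρ.HasFiniteMoment →
      ∫⁻ z, ENNReal.ofReal (κ * hypDist 0 z) ∂ρ.measure < ∞ := fun ρ hρ ↦ by
    simp only [ENNReal.ofReal_mul hκ]
    rw [lintegral_const_mul' _ _ ENNReal.ofReal_ne_top]
    exact ENNReal.mul_lt_top ENNReal.ofReal_lt_top hρ
  calc ∫⁻ p, ENNReal.ofReal (κ * hypDist p.1 p.2) ∂(μ.measure.prod ν.measure)
      ≤ ∫⁻ p, (ENNReal.ofReal (κ * hypDist 0 p.1) + ENNReal.ofReal (κ * hypDist 0 p.2))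
          ∂(μ.measure.prod ν.measure) := lintegral_mono fun p ↦ by
        simpa only [hypDist_comm 0 p.1] using ofReal_mul_hypDist_triangle hκ p.1 0 p.2
    _ = ∫⁻ z, ENNReal.ofReal (κ * hypDist 0 z) ∂μ.measure
          + ∫⁻ z, ENNReal.ofReal (κ * hypDist 0 z) ∂ν.measure := by
        rw [lintegral_add_left (by fun_prop), ← lintegral_map hm measurable_fst,
          ← lintegral_map hm measurable_snd, (prod_mem_couplings _ _).1, (prod_mem_couplings _ _).2]
    _ < ∞ := ENNReal.add_lt_top.mpr ⟨hfin μ hμ, hfin ν hν⟩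


/-! ### Existence of an optimal Möbius transformation and coupling -/

/-- The integral is the supremum over `n` of the integrals of the bounded continuous truncations
`min f n`, each of which is weakly continuous in the measure. -/
theorem lowerSemicontinuous_lintegral_probabilityMeasure {X : Type*} [TopologicalSpace X]
    [MeasurableSpace X] [OpensMeasurableSpace X] {f : X → NNReal} (hf : Continuous f) :
    LowerSemicontinuous fun π : ProbabilityMeasure X ↦ ∫⁻ x, f x ∂(π : Measure X) := by
  let g : ℕ → BoundedContinuousFunction X NNReal := fun n ↦
    BoundedContinuousFunction.mkOfBound ⟨fun x ↦ min (f x) n, by fun_prop⟩ n fun x y ↦ by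
      refine (Real.dist_le_of_mem_Icc (y := ((min (f y) n : NNReal) : ℝ)) (x' := 0) (y' := n)
        ⟨NNReal.coe_nonneg _, ?_⟩ ⟨NNReal.coe_nonneg _, ?_⟩).trans (by simp)
      · exact_mod_cast min_le_right (f x) (n : NNReal)
      · exact_mod_cast min_le_right (f y) (n : NNReal)
  have hsup : ∀ π : ProbabilityMeasure X,
      ∫⁻ x, f x ∂(π : Measure X) = ⨆ n, ∫⁻ x, g n x ∂(π : Measure X) := fun π ↦ by
    rw [← lintegral_iSup (fun n ↦ (g n).continuous.measurable.coe_nnreal_ennreal) fun n k h x ↦ ?_]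
    · refine lintegral_congr fun x ↦ le_antisymm ?_ (iSup_le fun n ↦ ?_)
      · obtain ⟨n, hn⟩ := exists_nat_ge (f x)
        refine le_iSup_of_le n ?_
        exact ENNReal.coe_le_coe.mpr (le_min le_rfl hn)
      · exact ENNReal.coe_le_coe.mpr (min_le_left _ _)
    · exact ENNReal.coe_le_coe.mpr (min_le_min_left _ (by exact_mod_cast h))
  simp only [hsup]
  exact lowerSemicontinuous_iSup fun n ↦
    (ProbabilityMeasure.continuous_lintegral_boundedContinuousFunction (g n)).lowerSemicontinuous

/-- If the integrand depends continuously on a parameter, then the integral is lower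
semicontinuous jointly in the parameter and the measure. -/
theorem lowerSemicontinuous_lintegral_prod {T X : Type*} [TopologicalSpace T]
    [TopologicalSpace.PseudoMetrizableSpace T] [SecondCountableTopology T]
    [TopologicalSpace X] [TopologicalSpace.PseudoMetrizableSpace X]
    [SecondCountableTopology X] [MeasurableSpace X] [BorelSpace X]
    {f : T × X → NNReal} (hf : Continuous f) :
    LowerSemicontinuous fun q : T × ProbabilityMeasure X ↦ ∫⁻ x, f (q.1, x) ∂(q.2 : Measure X) := by
  borelize T
  -- The parameter is absorbed into the measure: integrating `f (t, ·)` against `π` is integrating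
  -- `f` against `δ_t ⊗ π`, which depends continuously on `(t, π)`.
  have hc : Continuous fun q : T × ProbabilityMeasure X ↦ (diracProba q.1).prod q.2 :=
    ProbabilityMeasure.continuous_prod.comp
      ((continuous_diracProba.comp continuous_fst).prodMk continuous_snd)
  have h := (lowerSemicontinuous_lintegral_probabilityMeasure hf).comp hc
  have e : ∀ q : T × ProbabilityMeasure X, ∫⁻ x, f (q.1, x) ∂(q.2 : Measure X)
      = ∫⁻ p, f p ∂((diracProba q.1).prod q.2 : Measure (T × X)) := fun q ↦ by
    have hm := hf.measurable.coe_nnreal_ennreal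
    rw [ProbabilityMeasure.toMeasure_prod, lintegral_prod _ hm.aemeasurable]
    exact (lintegral_dirac' _ hm.lintegral_prod_right').symm
  simp only [e]
  exact h

/-- Closed because taking marginals is weakly continuous; tight because each marginal is a single
measure on a Polish space. Prokhorov's theorem concludes. -/
theorem isCompact_couplings (μ ν : Measure 𝔻) [IsProbabilityMeasure μ] [IsProbabilityMeasure ν] :
    IsCompact {π : ProbabilityMeasure (𝔻 × 𝔻) | (π : Measure (𝔻 × 𝔻)) ∈ couplings μ ν} := by
  have hclosed : IsClosed
      {π : ProbabilityMeasure (𝔻 × 𝔻) | (π : Measure (𝔻 × 𝔻)) ∈ couplings μ ν} := by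
    have e : {π : ProbabilityMeasure (𝔻 × 𝔻) | (π : Measure (𝔻 × 𝔻)) ∈ couplings μ ν}
        = {π | π.map measurable_fst.aemeasurable = ⟨μ, inferInstance⟩}
          ∩ {π | π.map measurable_snd.aemeasurable = ⟨ν, inferInstance⟩} := by
      ext π
      exact and_congr
        (ProbabilityMeasure.toMeasure_injective.eq_iff
          (a := π.map measurable_fst.aemeasurable) (b := ⟨μ, inferInstance⟩))
        (ProbabilityMeasure.toMeasure_injective.eq_iff
          (a := π.map measurable_snd.aemeasurable) (b := ⟨ν, inferInstance⟩))
    rw [e]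
    exact (isClosed_singleton.preimage (ProbabilityMeasure.continuous_map continuous_fst)).inter
      (isClosed_singleton.preimage (ProbabilityMeasure.continuous_map continuous_snd))
  rw [← hclosed.closure_eq]
  refine isCompact_closure_of_isTightMeasureSet (.prodMk ?_ ?_)
  · refine (isTightMeasureSet_singleton (μ := μ)).subset ?_
    rintro _ ⟨_, ⟨π, hπ, rfl⟩, rfl⟩
    exact hπ.1
  · refine (isTightMeasureSet_singleton (μ := ν)).subset ?_
    rintro _ ⟨_, ⟨π, hπ, rfl⟩, rfl⟩
    exact hπ.2

/-- The value 1/4 ensures that discarding one such exceptional set for each marginal keeps at least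
half the mass of a coupling. -/
theorem exists_measure_hypDist_le (μ : Measure 𝔻) [IsProbabilityMeasure μ] :
    ∃ R : ℝ, μ {z | hypDist z 0 ≤ R}ᶜ ≤ 4⁻¹ := by
  obtain ⟨K, hK, h⟩ := isTightMeasureSet_iff_exists_isCompact_measure_compl_le.mp
    (isTightMeasureSet_singleton (μ := μ)) 4⁻¹ (by simp)
  have hc : Continuous fun z : 𝔻 ↦ hypDist z 0 := by fun_prop
  obtain ⟨R, hR⟩ := hK.bddAbove_image hc.continuousOn
  refine ⟨R, (measure_mono ?_).trans (h μ rfl)⟩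
  exact Set.compl_subset_compl.mpr fun z hz ↦ hR ⟨z, hz, rfl⟩

/-- Möbius transformations whose transport cost is bounded do not move the origin far. -/
theorem exists_hypDist_le_of_lintegral_le {κ : ℝ} (hκ : 0 < κ) (μ ν : Measure 𝔻)
    [IsProbabilityMeasure μ] [IsProbabilityMeasure ν] {C : ℝ≥0∞} (hC : C ≠ ∞) :
    ∃ R : ℝ, ∀ (u : Circle) (a : 𝔻), ∀ π ∈ couplings μ ν,
      ∫⁻ p, ENNReal.ofReal (κ * hypDist (mobiusMap u a p.1) p.2) ∂π ≤ C → hypDist a 0 ≤ R := by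
  obtain ⟨r, hr⟩ := exists_measure_hypDist_le μ
  obtain ⟨s, hs⟩ := exists_measure_hypDist_le ν
  -- On a set `S` of mass at least 1/2 the cost is at least `κ (d(a, 0) - r - s)`, so half of this
  -- quantity is at most `C`; solving for `d(a, 0)` gives the radius.
  refine ⟨r + s + (2 * C).toReal / κ, fun u a π hπ h ↦ ?_⟩
  have := isProbabilityMeasure_of_mem_couplings hπ
  have hc : Measurable fun z : 𝔻 ↦ hypDist z 0 := by fun_prop
  have hmeas : ∀ t, MeasurableSet {z : 𝔻 | hypDist z 0 ≤ t} := fun t ↦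
    measurableSet_le hc measurable_const
  let S : Set (𝔻 × 𝔻) := {p | hypDist p.1 0 ≤ r} ∩ {p | hypDist p.2 0 ≤ s}
  have hSm : MeasurableSet S := (measurable_fst (hmeas r)).inter (measurable_snd (hmeas s))
  have hSc : π Sᶜ ≤ 2⁻¹ := by
    calc π Sᶜ ≤ π (Prod.fst ⁻¹' {z | hypDist z 0 ≤ r}ᶜ) + π (Prod.snd ⁻¹' {z | hypDist z 0 ≤ s}ᶜ) := by
          rw [Set.compl_inter]
          exact measure_union_le _ _
      _ ≤ 4⁻¹ + 4⁻¹ := by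
          rw [← Measure.map_apply measurable_fst (hmeas r).compl, hπ.1,
            ← Measure.map_apply measurable_snd (hmeas s).compl, hπ.2]
          exact add_le_add hr hs
      _ = 2⁻¹ := by
          rw [← two_mul, show (4 : ℝ≥0∞) = 2 * 2 by norm_num,
            ENNReal.mul_inv (by simp) (by simp), ← mul_assoc,
            ENNReal.mul_inv_cancel (by simp) (by simp), one_mul]
  have hS : 2⁻¹ ≤ π S := by
    have h1 : π S + π Sᶜ = 1 := (measure_add_measure_compl hSm).trans measure_univ
    by_contra hlt
    have : π S + π Sᶜ < 2⁻¹ + 2⁻¹ :=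
      ENNReal.add_lt_add_of_lt_of_le (measure_ne_top _ _) (not_le.mp hlt) hSc
    rw [h1, ENNReal.inv_two_add_inv_two] at this
    exact lt_irrefl _ this
  set t := hypDist a 0 - r - s with ht
  -- The map sends `a` to 0, so `d(a, p.1)` is the distance from the image of `p.1` to 0; two
  -- triangle inequalities then bound `d(a, 0)`.
  have hlow : ∀ p ∈ S, ENNReal.ofReal (κ * t)
      ≤ ENNReal.ofReal (κ * hypDist (mobiusMap u a p.1) p.2) := by
    rintro p ⟨hp1, hp2⟩
    refine ENNReal.ofReal_le_ofReal (mul_le_mul_of_nonneg_left ?_ hκ.le)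
    have h1 : hypDist (mobiusMap u a p.1) 0 = hypDist p.1 a := by
      rw [← mobiusMap_self u a, hypDist_mobiusMap]
    have h2 := hypDist_triangle (mobiusMap u a p.1) p.2 0
    have h3 := hypDist_triangle a p.1 0
    rw [hypDist_comm a p.1] at h3
    simp only [Set.mem_ofPred_eq] at hp1 hp2
    linarith
  have hmarkov : ENNReal.ofReal (κ * t) * 2⁻¹ ≤ C := by
    calc ENNReal.ofReal (κ * t) * 2⁻¹ ≤ ENNReal.ofReal (κ * t) * π S := by gcongr
      _ = ∫⁻ _ in S, ENNReal.ofReal (κ * t) ∂π := by rw [setLIntegral_const]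
      _ ≤ ∫⁻ p in S, ENNReal.ofReal (κ * hypDist (mobiusMap u a p.1) p.2) ∂π :=
          setLIntegral_mono' hSm hlow
      _ ≤ _ := (setLIntegral_le_lintegral _ _).trans h
  rw [← div_eq_mul_inv, ENNReal.div_le_iff (by simp) (by simp), mul_comm C,
    ENNReal.ofReal_le_iff_le_toReal (ENNReal.mul_ne_top (by simp) hC), ← le_div_iff₀' hκ] at hmarkov
  linarith

theorem exists_isMin_lintegral {κ : ℝ} (hκ : 0 < κ) (μ ν : Measure 𝔻)
    [IsProbabilityMeasure μ] [IsProbabilityMeasure ν] :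
    ∃ (u : Circle) (a : 𝔻), ∃ π ∈ couplings μ ν, ∀ (u' : Circle) (a' : 𝔻), ∀ π' ∈ couplings μ ν,
      ∫⁻ p, ENNReal.ofReal (κ * hypDist (mobiusMap u a p.1) p.2) ∂π
        ≤ ∫⁻ p, ENNReal.ofReal (κ * hypDist (mobiusMap u' a' p.1) p.2) ∂π' := by
  by_cases hfin : ∃ (u : Circle) (a : 𝔻), ∃ π ∈ couplings μ ν,
      ∫⁻ p, ENNReal.ofReal (κ * hypDist (mobiusMap u a p.1) p.2) ∂π ≠ ∞
  swap
  -- If every cost is infinite, any triple is a minimiser.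
  · push Not at hfin
    exact ⟨1, 0, _, prod_mem_couplings μ ν, fun u' a' π' h' ↦ by simp [hfin u' a' π' h']⟩
  obtain ⟨u₀, a₀, π₀, h₀, hC⟩ := hfin
  obtain ⟨R, hR⟩ := exists_hypDist_le_of_lintegral_le hκ μ ν hC
  let P₀ : ProbabilityMeasure (𝔻 × 𝔻) := ⟨π₀, isProbabilityMeasure_of_mem_couplings h₀⟩
  have hf : Continuous fun q : (Circle × 𝔻) × (𝔻 × 𝔻) ↦
      Real.toNNReal (κ * hypDist (mobiusMap q.1.1 q.1.2 q.2.1) q.2.2) := by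
    have h1 : Continuous fun q : (Circle × 𝔻) × (𝔻 × 𝔻) ↦ mobiusMap q.1.1 q.1.2 q.2.1 :=
      continuous_mobiusMap.comp (by fun_prop : Continuous fun q : (Circle × 𝔻) × (𝔻 × 𝔻) ↦
        ((q.1.1, q.1.2), q.2.1))
    fun_prop
  have hlsc := lowerSemicontinuous_lintegral_prod hf
  have hK : IsCompact ((Set.univ ×ˢ {a : 𝔻 | hypDist a 0 ≤ R}) ×ˢ
      {π : ProbabilityMeasure (𝔻 × 𝔻) | (π : Measure (𝔻 × 𝔻)) ∈ couplings μ ν} :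
        Set ((Circle × 𝔻) × ProbabilityMeasure (𝔻 × 𝔻))) :=
    (isCompact_univ.prod (isCompact_setOf_hypDist_le R)).prod (isCompact_couplings μ ν)
  have hmem₀ : ((u₀, a₀), P₀) ∈
      ((Set.univ ×ˢ {a : 𝔻 | hypDist a 0 ≤ R}) ×ˢ
      {π : ProbabilityMeasure (𝔻 × 𝔻) | (π : Measure (𝔻 × 𝔻)) ∈ couplings μ ν} :
        Set ((Circle × 𝔻) × ProbabilityMeasure (𝔻 × 𝔻))) :=
    ⟨⟨trivial, hR u₀ a₀ π₀ h₀ le_rfl⟩, h₀⟩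
  obtain ⟨⟨⟨u, a⟩, π⟩, ⟨-, hπ⟩, hmin⟩ :=
    (hlsc.lowerSemicontinuousOn _).exists_isMinOn ⟨_, hmem₀⟩ hK
  have hmin' := isMinOn_iff.mp hmin
  refine ⟨u, a, π, hπ, fun u' a' π' h' ↦ ?_⟩
  let P' : ProbabilityMeasure (𝔻 × 𝔻) := ⟨π', isProbabilityMeasure_of_mem_couplings h'⟩
  -- A competitor no costlier than the reference triple lies in the compact set; a costlier one is
  -- already beaten by the reference.
  by_cases hle : ∫⁻ p, ENNReal.ofReal (κ * hypDist (mobiusMap u' a' p.1) p.2) ∂π'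
      ≤ ∫⁻ p, ENNReal.ofReal (κ * hypDist (mobiusMap u₀ a₀ p.1) p.2) ∂π₀
  · exact hmin' ((u', a'), P') ⟨⟨trivial, hR u' a' π' h' hle⟩, h'⟩
  · exact (hmin' _ hmem₀).trans (not_le.mp hle).le

theorem transportDist_smul_le_lintegral (κ : ℝ) (m : DiskMobius) {μ ν : ConformalDensity}
    {π : Measure (𝔻 × 𝔻)} (h : π ∈ couplings μ.measure ν.measure) :
    transportDist κ (m • μ) ν
      ≤ ∫⁻ p, ENNReal.ofReal (κ * hypDist ((m : Equiv.Perm 𝔻) p.1) p.2) ∂π := by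
  have hm := (continuous_diskMobius m).measurable
  have h' := map_prodMap_mem_couplings h hm measurable_id
  rw [← ConformalDensity.measure_smul, Measure.map_id] at h'
  refine (transportDist_le_lintegral h').trans_eq ?_
  rw [lintegral_map (measurable_cost κ) (hm.prodMap measurable_id)]
  rfl

/-- Together with `transportDist_smul_le_lintegral` this moves `m` from the marginal into the cost,
so that the set of couplings no longer depends on `m`. -/
theorem exists_coupling_of_smul (κ : ℝ) (m : DiskMobius) {μ ν : ConformalDensity}
    {π : Measure (𝔻 × 𝔻)} (h : π ∈ couplings (m • μ).measure ν.measure) :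
    ∃ π' ∈ couplings μ.measure ν.measure,
      ∫⁻ p, ENNReal.ofReal (κ * hypDist ((m : Equiv.Perm 𝔻) p.1) p.2) ∂π'
        = ∫⁻ p, ENNReal.ofReal (κ * hypDist p.1 p.2) ∂π := by
  have hm := (continuous_diskMobius m).measurable
  have hm' := (continuous_diskMobius m⁻¹).measurable
  have h' := map_prodMap_mem_couplings h hm' measurable_id
  rw [← ConformalDensity.measure_smul, Measure.map_id, inv_smul_smul] at h'
  refine ⟨_, h', ?_⟩
  rw [lintegral_map (by fun_prop) (hm'.prodMap measurable_id)]
  refine lintegral_congr fun p ↦ ?_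
  simp

/-- There are a Möbius transformation and a coupling that together realize `quotDist κ μ ν`. -/
theorem exists_quotDist_eq_lintegral {κ : ℝ} (hκ : 0 < κ) (μ ν : ConformalDensity) :
    ∃ m : DiskMobius, quotDist κ μ ν = transportDist κ (m • μ) ν ∧
      ∃ π ∈ couplings (m • μ).measure ν.measure,
        quotDist κ μ ν = ∫⁻ p, ENNReal.ofReal (κ * hypDist p.1 p.2) ∂π := by
  obtain ⟨u, a, π, hπ, hmin⟩ := exists_isMin_lintegral hκ μ.measure ν.measure
  obtain ⟨m, hm⟩ := exists_diskMobius u a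
  have hmm := (continuous_diskMobius m).measurable
  have hle : ∫⁻ p, ENNReal.ofReal (κ * hypDist ((m : Equiv.Perm 𝔻) p.1) p.2) ∂π
      ≤ quotDist κ μ ν := by
    refine le_iInf fun m' ↦ le_iInf₂ fun π' hπ' ↦ ?_
    obtain ⟨π'', hπ'', e⟩ := exists_coupling_of_smul κ m' hπ'
    obtain ⟨u', a', hm'⟩ := m'.2
    rw [← e]
    simpa only [hm, hm'] using hmin u' a' π'' hπ''
  have hge : quotDist κ μ ν ≤ transportDist κ (m • μ) ν := iInf_le _ m
  have hmid := transportDist_smul_le_lintegral κ m hπ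
  refine ⟨m, le_antisymm hge (hmid.trans hle), π.map (Prod.map (m : Equiv.Perm 𝔻) id), ?_, ?_⟩
  · simpa only [← ConformalDensity.measure_smul, Measure.map_id] using
      map_prodMap_mem_couplings hπ hmm measurable_id
  · rw [lintegral_map (measurable_cost κ) (hmm.prodMap measurable_id)]
    exact le_antisymm (hge.trans hmid) hle

/-- An optimal coupling of cost zero is concentrated on the diagonal, where the two projections
agree almost everywhere, so its marginals are equal. -/
theorem exists_eq_smul_of_quotDist_eq_zero {κ : ℝ} (hκ : 0 < κ) {μ ν : ConformalDensity}
    (h : quotDist κ μ ν = 0) : ∃ m : DiskMobius, ν = m • μ := by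
  obtain ⟨m, -, π, hπ, e⟩ := exists_quotDist_eq_lintegral hκ μ ν
  refine ⟨m, ConformalDensity.measure_injective ?_⟩
  rw [h, eq_comm, lintegral_eq_zero_iff (measurable_cost κ)] at e
  rw [← hπ.1, ← hπ.2]
  refine Measure.map_congr ?_
  filter_upwards [e] with p hp
  have h0 : κ * hypDist p.1 p.2 ≤ 0 := ENNReal.ofReal_eq_zero.mp hp
  exact (hypDist_eq_zero.mp (le_antisymm (nonpos_of_mul_nonpos_right h0 hκ)
    (hypDist_nonneg _ _))).symm

/-! ### The quotient distance is a metric on orbits -/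

theorem quotDist_smul_left (κ : ℝ) (m : DiskMobius) (μ ν : ConformalDensity) :
    quotDist κ (m • μ) ν = quotDist κ μ ν := by
  rw [quotDist, quotDist, ← (Equiv.mulRight m).iInf_comp (g := fun m' ↦ transportDist κ (m' • μ) ν)]
  exact iInf_congr fun m' ↦ by rw [Equiv.coe_mulRight, mul_smul]

/-- Reindex the infimum by `m ↦ m⁻¹` and apply `m` to both arguments. -/
theorem quotDist_comm (κ : ℝ) (μ ν : ConformalDensity) : quotDist κ μ ν = quotDist κ ν μ := by
  rw [quotDist, quotDist, ← (Equiv.inv DiskMobius).iInf_comp]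
  refine iInf_congr fun m ↦ ?_
  rw [Equiv.inv_apply, ← transportDist_smul_smul κ m, smul_inv_smul, transportDist_comm]

theorem quotDist_smul_right (κ : ℝ) (m : DiskMobius) (μ ν : ConformalDensity) :
    quotDist κ μ (m • ν) = quotDist κ μ ν := by
  rw [quotDist_comm, quotDist_smul_left, quotDist_comm]

theorem quotDist_self (κ : ℝ) (μ : ConformalDensity) : quotDist κ μ μ = 0 :=
  le_antisymm ((iInf_le _ 1).trans_eq (by rw [one_smul, transportDist_self])) bot_le

theorem quotDist_triangle {κ : ℝ} (hκ : 0 ≤ κ) (μ ν ρ : ConformalDensity) :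
    quotDist κ μ ρ ≤ quotDist κ μ ν + quotDist κ ν ρ := by
  refine ENNReal.le_iInf_add_iInf fun m₁ m₂ ↦ ?_
  -- The product `m₂ * m₁` is the competitor; invariance under `m₂` reduces the first leg to the
  -- transport from `m₁ • μ` to `ν`.
  calc quotDist κ μ ρ ≤ transportDist κ ((m₂ * m₁) • μ) ρ := iInf_le _ _
    _ ≤ transportDist κ (m₂ • m₁ • μ) (m₂ • ν) + transportDist κ (m₂ • ν) ρ := by
        rw [mul_smul]
        exact transportDist_triangle hκ _ _ _
    _ = _ := by rw [transportDist_smul_smul]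

theorem ConformalDensity.orbit_eq_orbit {μ ν : ConformalDensity} :
    μ.orbit = ν.orbit ↔ ∃ m : DiskMobius, m • ν = μ := by
  rw [orbit, orbit, Quotient.eq, MulAction.orbitRel_apply, MulAction.mem_orbit_iff]

/-- The quotient distance as a function on orbits. -/
def orbitDist (κ : ℝ) : MobiusOrbit → MobiusOrbit → ℝ≥0∞ :=
  Quotient.lift₂ (quotDist κ) fun _ _ _ _ ⟨m₁, h₁⟩ ⟨m₂, h₂⟩ ↦ by
    subst h₁ h₂
    simp only [quotDist_smul_left, quotDist_smul_right]

theorem orbitDist_orbit (κ : ℝ) (μ ν : ConformalDensity) :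
    orbitDist κ μ.orbit ν.orbit = quotDist κ μ ν := rfl

/-- The extended metric space structure on orbits given by the quotient distance. -/
abbrev orbitEMetricSpace {κ : ℝ} (hκ : 0 < κ) : EMetricSpace MobiusOrbit where
  edist := orbitDist κ
  edist_self c := Quotient.inductionOn c fun μ ↦ quotDist_self κ μ
  edist_comm c d := Quotient.inductionOn₂ c d fun μ ν ↦ quotDist_comm κ μ ν
  edist_triangle c d e := Quotient.inductionOn₃ c d e fun μ ν ρ ↦ quotDist_triangle hκ.le μ ν ρ
  eq_of_edist_eq_zero {c d} := Quotient.inductionOn₂ c d fun μ ν h ↦ by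
    obtain ⟨m, hm⟩ := exists_eq_smul_of_quotDist_eq_zero hκ h
    exact (ConformalDensity.orbit_eq_orbit.mpr ⟨m, hm.symm⟩).symm

theorem orbitDist_ne_top {κ : ℝ} (hκ : 0 ≤ κ) {c d : MobiusOrbit} (hc : c ∈ finiteMomentOrbits)
    (hd : d ∈ finiteMomentOrbits) : orbitDist κ c d ≠ ∞ := by
  obtain ⟨μ, hμ, rfl⟩ := hc
  obtain ⟨ν, hν, rfl⟩ := hd
  rw [orbitDist_orbit]
  refine ((iInf_le _ 1).trans_lt ?_).ne
  rw [one_smul]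
  exact transportDist_lt_top hκ hμ hν

end

theorem mainTheorem5 (κ : ℝ) (hκ : 0 < κ) :
    -- the distance is well defined on orbits and is an extended metric there
    (∃ E : EMetricSpace MobiusOrbit, ∀ μ ν : ConformalDensity,
      E.edist μ.orbit ν.orbit = quotDist κ μ ν) ∧
    -- it is finite, hence a genuine metric, on orbits with finite first moment
    (∃ M : MetricSpace finiteMomentOrbits, ∀ (c c' : finiteMomentOrbits) (μ ν : ConformalDensity),
      μ.orbit = c → ν.orbit = c' → ENNReal.ofReal (M.dist c c') = quotDist κ μ ν) ∧
    -- the infimum over Möbius transformations is attained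
    (∀ μ ν : ConformalDensity, ∃ m : DiskMobius, quotDist κ μ ν = transportDist κ (m • μ) ν) ∧
    -- densities at distance zero lie in the same orbit
    (∀ μ ν : ConformalDensity, quotDist κ μ ν = 0 → ∃ m : DiskMobius, ν = m • μ) := by
  refine ⟨⟨orbitEMetricSpace hκ, orbitDist_orbit κ⟩, ?_, fun μ ν ↦ ?_,
    fun μ ν h ↦ exists_eq_smul_of_quotDist_eq_zero hκ h⟩
  · let := orbitEMetricSpace hκ
    have hne : ∀ c d : finiteMomentOrbits, edist c d ≠ ∞ := fun c d ↦
      orbitDist_ne_top hκ.le c.2 d.2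
    refine ⟨EMetricSpace.toMetricSpace hne, fun c d μ ν hc hd ↦ ?_⟩
    rw [← orbitDist_orbit, hc, hd]
    -- The real distance is the `toReal` of the extended one, so finiteness is needed to recover it.
    exact ENNReal.ofReal_toReal (hne c d)
  · obtain ⟨m, hm, -⟩ := exists_quotDist_eq_lintegral hκ μ ν
    exact ⟨m, hm⟩
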